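/- **Networks.** Let $(V_0,E_0)$ be the graph of the icosahedron ($12$ vertices, $30$ edges). Given $(V_i,E_i)$, let $V_{i+1}=V_i\sqcup L_{i+1}$, where $L_{i+1}$ contains one new vertex (the midpoint) for each edge in $E_i$. The edges $E_{i+1}$ join each midpoint to the two endpoints of its edge, and join the midpoints of $\{a,b\}$ and $\{a,c\}$ whenever $\{a,b\},\{a,c\},\{b,c\}\in E_i$ form a triangle. The network after $k$ subdivisions is $G_k=(V_k,\bigcup_{i=0}^k E_i)$; its vertices are the nodes, and $N=|V_k|$. The layer of $\alpha$ is $l(\alpha)=i$ if $\alpha\in L_i$, with $L_0=V_0$. Distances $d$ and neighbours $N(\alpha)$ refer to $G_k$. The parents of $\alpha$ are $p(\alpha)=\{\beta\in N(\alpha):l(\beta)<l(\alpha)\}$, and $p(A)=\bigcup_{\alpha\in A}p(\alpha)$. The 6th-order neighbourhood is $N^\alpha=\{\gamma\in V_k:d(\alpha,\gamma)\le 6\}$. **Labels.** Let $p^{\mathrm{good}}(A)$ be the set of elements of $p(A)$ on the lowest layer that occurs in $p(A)$, and $B=p^{\mathrm{good}}(A)$. Put $f(A)=B$ if $B$ meets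 $V_0$, and $f(A)=\{\beta\in B: p(\beta)\cap p^{\mathrm{good}}(B)\neq\emptyset\}$ otherwise. The label of $\alpha$ is the list $\mathrm{label}(\alpha)=[\{\alpha\},f(\{\alpha\}),f(f(\{\alpha\})),\dots]$, which ends with the first entry that meets $V_0$. Write $\mathrm{label}(\alpha)_i$ for its $i$-th entry ($i\ge1$). **Local sphere routing algorithm.** Node $\alpha$ permanently stores its ID, its label, and its 6th-order neighbourhood (the set $N^\alpha$ and the edges of $G_k$ between nodes of $N^\alpha$). It receives $\mathrm{label}(\beta)$ for a destination $\beta$ and does the following. 1. If $\alpha=\beta$, stop. 2. Otherwise, if $\alpha\in\mathrm{label}(\beta)_i$ for some $i$, return a random element of $\mathrm{label}(\beta)_{i-1}\cap N(\alpha)$. 3. Otherwise, let $L_\beta=\bigcup_j\mathrm{label}(\beta)_j$. If $L_\beta\cap N^\alpha\ne\emptyset$, run Dijkstra's algorithm in the subgraph induced by $N^\alpha$ from $\alpha$ to each $\gamma\in L_\beta\cap N^\alpha$, and return a shortest one of the paths found. 4. Otherwise, return a random element of $\mathrm{label}(\alpha)_2$. Memory is measured in the uniform cost model: a node ID or a number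 takes one word. The memory in use at a node at some moment of a run consists of the stored data, the received label and the working memory (for Dijkstra's algorithm: the unsettled vertices and the tables of tentative distances and predecessors). **Theorem (Memory size).** There is an absolute constant $C$ such that: * for all $k\ge 0$ and every node $\alpha$ of $G_k$, the label of $\alpha$ takes at most $C\log N$ words; * for all $k\ge1$ and every node $\alpha$ of $G_k$, $|N^\alpha|\le C k^6$; * for all $k\ge 0$ and all nodes $\alpha,\beta$ of $G_k$, at every moment of every run of the local sphere routing algorithm at $\alpha$ with destination $\beta$ (whatever the random choices), the memory in use at $\alpha$ is at most $C\log^6 N$ words. That is, the classical memory per node is $O(\log^6 N)$. -/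

import Mathlib

namespace SphereNet

/-- One subdivision step. The vertices are the old vertices together with one midpoint for each
edge. A midpoint is joined to the two endpoints of its edge, and the midpoints of two distinct
edges `{a, b}`, `{a, c}` are joined when `{b, c}` is an edge too (so that `a, b, c` is a triangle).
Old vertices are not joined to each other. -/
def subdivide {V : Type} (G : SimpleGraph V) : SimpleGraph (V ⊕ G.edgeSet) where
  Adj
    | .inl _, .inl _ => False
    | .inl v, .inr e => v ∈ e.1
    | .inr e, .inl v => v ∈ e.1
    | .inr e, .inr e' => ∃ a b c : V, e.1 = s(a, b) ∧ e'.1 = s(a, c) ∧ G.Adj b c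
  symm := ⟨by
    rintro (v | e) (w | e') h
    · exact h
    · exact h
    · exact h
    · obtain ⟨a, b, c, h1, h2, h3⟩ := h
      exact ⟨a, c, b, h2, h1, h3.symm⟩⟩
  loopless := ⟨by
    rintro (v | e) h
    · exact h
    · obtain ⟨a, b, c, h1, h2, h3⟩ := h
      have hbc : b = c := Sym2.congr_right.mp (h1.symm.trans h2)
      exact G.loopless.irrefl b (hbc ▸ h3)⟩

/-- The icosahedron: poles `0` and `11`, upper ring `1, …, 5`, lower ring `6, …, 10`. -/
def icosahedron : SimpleGraph (Fin 12) :=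
  SimpleGraph.fromEdgeSet
    {s(0, 1), s(0, 2), s(0, 3), s(0, 4), s(0, 5),
     s(1, 2), s(2, 3), s(3, 4), s(4, 5), s(5, 1),
     s(1, 6), s(2, 7), s(3, 8), s(4, 9), s(5, 10),
     s(1, 7), s(2, 8), s(3, 9), s(4, 10), s(5, 6),
     s(6, 7), s(7, 8), s(8, 9), s(9, 10), s(10, 6),
     s(11, 6), s(11, 7), s(11, 8), s(11, 9), s(11, 10)}

/-- The network after some number `i` of subdivisions: its nodes `V_i`, the graph `(V_i, E_i)` of the
edges generated last, the graph `G_i` with all edges `E_0 ∪ ⋯ ∪ E_i`, and the layer of each node. -/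
structure Network where
  Node : Type
  [fintypeNode : Fintype Node]
  [decEqNode : DecidableEq Node]
  fine : SimpleGraph Node
  graph : SimpleGraph Node
  layer : Node → ℕ

attribute [instance] Network.fintypeNode Network.decEqNode

/-- The network `G_k` obtained from the icosahedron by `k` subdivisions. -/
noncomputable def network : ℕ → Network
  | 0 =>
    { Node := Fin 12
      fine := icosahedron
      graph := icosahedron
      layer := fun _ => 0 }
  | k + 1 =>
    { Node := (network k).Node ⊕ (network k).fine.edgeSet
      fintypeNode := Fintype.ofFinite _
      decEqNode := Classical.decEq _
      fine := subdivide (network k).fine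
      graph := (network k).graph.map Function.Embedding.inl ⊔ subdivide (network k).fine
      layer := Sum.elim (network k).layer (fun _ => k + 1) }

namespace Network

variable (S : Network)

open Classical in
/-- The parents `p(α)`: the neighbours on a lower layer. -/
noncomputable def parents (a : S.Node) : Finset S.Node :=
  Finset.univ.filter fun b => S.graph.Adj a b ∧ S.layer b < S.layer a

/-- `p(A)`, the union of the `p(α)` over `α ∈ A`. -/
noncomputable def parentsOf (A : Finset S.Node) : Finset S.Node :=
  A.biUnion S.parents

/-- The elements of `p(A)` on the lowest layer. -/
noncomputable def goodParents (A : Finset S.Node) : Finset S.Node :=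
  (S.parentsOf A).filter fun b => ∀ c ∈ S.parentsOf A, S.layer b ≤ S.layer c

open Classical in
/-- The filter `f` that applies the Parent Rule and the Grandparent Rule. -/
noncomputable def labelFilter (A : Finset S.Node) : Finset S.Node :=
  if ∃ b ∈ S.goodParents A, S.layer b = 0 then S.goodParents A
  else (S.goodParents A).filter fun b =>
    (S.parents b ∩ S.goodParents (S.goodParents A)).Nonempty

theorem labelFilter_subset (A : Finset S.Node) : S.labelFilter A ⊆ S.parentsOf A := by
  unfold labelFilter
  split_ifs
  · exact Finset.filter_subset _ _
  · exact (Finset.filter_subset _ _).trans (Finset.filter_subset _ _)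

open Classical in
/-- The list `[A, f(A), f(f(A)), …]`, up to the first entry that meets layer `0`.
(The clause for `A = ∅` only serves to make the recursion terminate; it is never used.) -/
noncomputable def labelFrom (A : Finset S.Node) : List (Finset S.Node) :=
  if A = ∅ ∨ ∃ a ∈ A, S.layer a = 0 then [A]
  else A :: labelFrom (S.labelFilter A)
termination_by A.sup S.layer
decreasing_by
  rename_i h
  push Not at h
  obtain ⟨⟨a, ha⟩, h0⟩ := h
  have hpos : 0 < A.sup S.layer :=
    lt_of_lt_of_le (Nat.pos_of_ne_zero (h0 a ha)) (Finset.le_sup ha)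
  refine (Finset.sup_lt_iff hpos).2 fun b hb => ?_
  obtain ⟨c, hc, hbc⟩ := Finset.mem_biUnion.1 (S.labelFilter_subset A hb)
  exact lt_of_lt_of_le (Finset.mem_filter.1 hbc).2.2 (Finset.le_sup hc)

/-- The label of a node. Entry `i` of the list is `label(α)_{i+1}`, as lists are indexed from `0`. -/
noncomputable def label (a : S.Node) : List (Finset S.Node) := S.labelFrom {a}

open Classical in
/-- The 6th-order neighbourhood `N^α` of a node. -/
noncomputable def nbhd (a : S.Node) : Finset S.Node :=
  Finset.univ.filter fun c => S.graph.edist a c ≤ 6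

open Classical in
/-- The edges of the subgraph of the network that is induced by `N^α`. -/
noncomputable def nbhdEdges (a : S.Node) : Finset (Sym2 S.Node) :=
  Finset.univ.filter fun e => e ∈ S.graph.edgeSet ∧ ∀ c ∈ e, c ∈ S.nbhd a

end Network

/-! Memory is counted in the uniform cost model: a node ID and a number take one word each. -/

/-- Words taken by a label: the IDs in its entries and, for each entry, their number. -/
def labelWords {V : Type} (l : List (Finset V)) : ℕ :=
  (l.map fun A => A.card + 1).sum

/-- What a node stores permanently: its ID, its label, and its 6th-order neighbourhood with the
links inside it. -/
structure LocalData (V : Type) where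
  self : V
  label : List (Finset V)
  nbhd : Finset V
  links : Finset (Sym2 V)

/-- Words taken by the permanently stored data (two for each link). -/
def LocalData.words {V : Type} (M : LocalData V) : ℕ :=
  1 + labelWords M.label + M.nbhd.card + 2 * M.links.card

/-- The data stored at node `a`. -/
noncomputable def Network.localData (S : Network) (a : S.Node) : LocalData S.Node where
  self := a
  label := S.label a
  nbhd := S.nbhd a
  links := S.nbhdEdges a

/-- The neighbours of a node `v` of the stored subgraph, read off from the stored links. -/
def LocalData.neighbors {V : Type} [DecidableEq V] (M : LocalData V) (v : V) : Finset V :=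
  M.nbhd.filter fun w => s(v, w) ∈ M.links

/-- The working memory of Dijkstra's algorithm: the target, the vertices that are not settled yet,
and the tables of tentative distances and of predecessors (`none`: no entry). -/
structure Dijkstra (V : Type) where
  target : V
  queue : Finset V
  dist : V → Option ℕ
  pred : V → Option V

namespace Dijkstra

variable {V : Type}

/-- Words taken by the working memory (two for each table entry, a key and a value). -/
def words [Fintype V] (D : Dijkstra V) : ℕ :=
  1 + D.queue.card
    + 2 * (Finset.univ.filter fun v => (D.dist v).isSome).card
    + 2 * (Finset.univ.filter fun v => (D.pred v).isSome).card

/-- The state before the first step: only the source, the node itself, has a distance, `0`. -/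
def start [DecidableEq V] (M : LocalData V) (t : V) : Dijkstra V where
  target := t
  queue := M.nbhd
  dist := Function.update (fun _ => none) M.self (some 0)
  pred := fun _ => none

/-- `u` is an unsettled vertex of least tentative distance. -/
def IsNext (D : Dijkstra V) (u : V) : Prop :=
  u ∈ D.queue ∧ ∃ d, D.dist u = some d ∧ ∀ v ∈ D.queue, ∀ d', D.dist v = some d' → d ≤ d'

/-- Remove `u` from the unsettled vertices. -/
def settle [DecidableEq V] (D : Dijkstra V) (u : V) : Dijkstra V :=
  { D with queue := D.queue.erase u }

/-- The path to `v` through `u` is shorter than the best one known so far (links have length `1`). -/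
def Improves (D : Dijkstra V) (u v : V) : Prop :=
  ∃ d, D.dist u = some d ∧ ∀ d', D.dist v = some d' → d + 1 < d'

open Classical in
/-- Relax the link from `u` to `v`. -/
noncomputable def relax (D : Dijkstra V) (u v : V) : Dijkstra V :=
  if D.Improves u v then
    { D with
      dist := Function.update D.dist v ((D.dist u).map (· + 1))
      pred := Function.update D.pred v (some u) }
  else D

end Dijkstra

/-- The working memory of a node while it runs the local routing algorithm. One constructor for each
control point of the program; its arguments are the variables that are alive there. -/
inductive Work (V : Type) where
  /-- The program starts. -/
  | start
  /-- About to test whether the node is in entry `i + 1` (counted from `0`) of the label. -/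
  | scan (i : ℕ)
  /-- About to return a random element of `A`. -/
  | pick (A : Finset V)
  /-- The union `L` of the first `j` entries of the label has been formed. -/
  | gather (j : ℕ) (L : Finset V)
  /-- The union `L` of all entries, and its intersection `I` with the neighbourhood. -/
  | meet (L I : Finset V)
  /-- The targets `I` remain to be treated; `best` is the shortest path found so far. -/
  | loop (I : Finset V) (best : Option (List V))
  /-- Dijkstra's algorithm is running. -/
  | search (I : Finset V) (best : Option (List V)) (D : Dijkstra V)
  /-- Dijkstra's algorithm has settled `u`; the links from `u` to `R` remain to be relaxed. -/
  | relax (I : Finset V) (best : Option (List V)) (D : Dijkstra V) (u : V) (R : Finset V)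
  /-- The end `P` of the path to the target has been read from the predecessor table. -/
  | readPath (I : Finset V) (best : Option (List V)) (D : Dijkstra V) (P : List V)
  /-- The program has stopped and returned a path of nodes that starts at the node itself. -/
  | halt (P : List V)

/-- Words taken by an optional path. -/
def pathWords {V : Type} (best : Option (List V)) : ℕ :=
  (best.map List.length).getD 0

/-- Words taken by the working memory. -/
def Work.words {V : Type} [Fintype V] : Work V → ℕ
  | start => 0
  | scan _ => 1
  | pick A => A.card
  | gather _ L => 1 + L.card
  | meet L I => L.card + I.card
  | loop I best => I.card + pathWords best
  | search I best D => I.card + pathWords best + D.words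
  | relax I best D _ R => I.card + pathWords best + D.words + 1 + R.card
  | readPath I best D P => I.card + pathWords best + D.words + P.length
  | halt P => P.length

open Classical in
/-- The shorter one of the path `P` and the best path known so far. -/
noncomputable def shorter {V : Type} (best : Option (List V)) (P : List V) : List V :=
  match best with
  | none => P
  | some Q => if P.length < Q.length then P else Q

/-- One step of the local routing algorithm at a node with stored data `M` that has received the
label `lb` of the destination. The program has access to nothing else. Random choices, the order of
loops and the breaking of ties in Dijkstra's algorithm are left open. -/
inductive Step {V : Type} [DecidableEq V] (M : LocalData V) (lb : List (Finset V)) :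
    Work V → Work V → Prop
  /-- The node is the destination (the first entry of a label contains just the node itself). -/
  | arrived : lb[0]? = some {M.self} → Step M lb .start (.halt [M.self])
  | notArrived : lb[0]? ≠ some {M.self} → Step M lb .start (.scan 0)
  /-- The node is in entry `i + 1`: go to a neighbour in entry `i`. -/
  | found (i : ℕ) (A B : Finset V) : lb[i + 1]? = some A → M.self ∈ A → lb[i]? = some B →
      Step M lb (.scan i) (.pick (B ∩ M.neighbors M.self))
  | notFound (i : ℕ) (A : Finset V) : lb[i + 1]? = some A → M.self ∉ A →
      Step M lb (.scan i) (.scan (i + 1))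
  | notInLabel (i : ℕ) : lb[i + 1]? = none → Step M lb (.scan i) (.gather 0 ∅)
  | gather (j : ℕ) (A L : Finset V) : lb[j]? = some A →
      Step M lb (.gather j L) (.gather (j + 1) (L ∪ A))
  | gathered (j : ℕ) (L : Finset V) : lb[j]? = none →
      Step M lb (.gather j L) (.meet L (L ∩ M.nbhd))
  /-- No vertex of the label is near: go to a parent in the second entry of the own label. -/
  | far (L A : Finset V) : M.label[1]? = some A → Step M lb (.meet L ∅) (.pick A)
  | near (L I : Finset V) : I.Nonempty → Step M lb (.meet L I) (.loop I none)
  | pick (A : Finset V) (c : V) : c ∈ A → Step M lb (.pick A) (.halt [M.self, c])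
  /-- Run Dijkstra's algorithm for the next target. -/
  | target (I : Finset V) (best : Option (List V)) (c : V) : c ∈ I →
      Step M lb (.loop I best) (.search (I.erase c) best (.start M c))
  | settle (I : Finset V) (best : Option (List V)) (D : Dijkstra V) (u : V) :
      D.IsNext u → u ≠ D.target →
      Step M lb (.search I best D)
        (.relax I best (D.settle u) u ((D.settle u).queue ∩ M.neighbors u))
  | relax (I : Finset V) (best : Option (List V)) (D : Dijkstra V) (u v : V) (R : Finset V) :
      v ∈ R → Step M lb (.relax I best D u R) (.relax I best (D.relax u v) u (R.erase v))
  | relaxed (I : Finset V) (best : Option (List V)) (D : Dijkstra V) (u : V) :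
      Step M lb (.relax I best D u ∅) (.search I best D)
  | reached (I : Finset V) (best : Option (List V)) (D : Dijkstra V) :
      D.IsNext D.target → Step M lb (.search I best D) (.readPath I best D [D.target])
  | readBack (I : Finset V) (best : Option (List V)) (D : Dijkstra V) (u v : V) (P : List V) :
      v ≠ M.self → D.pred v = some u →
      Step M lb (.readPath I best D (v :: P)) (.readPath I best D (u :: v :: P))
  | compare (I : Finset V) (best : Option (List V)) (D : Dijkstra V) (P : List V) :
      Step M lb (.readPath I best D (M.self :: P))
        (.loop I (some (shorter best (M.self :: P))))
  | finish (P : List V) : Step M lb (.loop ∅ (some P)) (.halt P)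

/-- `w` is the working memory at some moment of some run of the local routing algorithm at node `a`
for the destination `b`. -/
def Network.Occurs (S : Network) (a b : S.Node) (w : Work S.Node) : Prop :=
  Relation.ReflTransGen (Step (S.localData a) (S.label b)) .start w

/-- The total memory, in words, in use at node `a` when the working memory is `w`: the stored data,
the received label of the destination `b`, the working memory, and one word for the control point. -/
noncomputable def Network.memory (S : Network) (a b : S.Node) (w : Work S.Node) : ℕ :=
  (S.localData a).words + labelWords (S.label b) + w.words + 1

/-- The number `N` of nodes of a network. -/
def Network.size (S : Network) : ℕ := Fintype.card S.Node

end SphereNet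

/-!
The network `G_k` is controlled by two facts about one subdivision step.

*Degrees.* Subdivision preserves `IsTame`: degree at most `6`, at most two triangles on each edge and
no complete subgraph on four vertices (`IsTame.subdivide`). So a node gets at most six new links per
subdivision, its degree in `G_k` is at most `6 * (k + 1)`, and a ball of radius `6` has at most
`(7 * (k + 1)) ^ 6` nodes. The links inside such a ball are only linearly many in its nodes, because
each link can be charged to an endpoint together with which it was generated, and no node is charged
more than six times (`card_nbhdEdges_le`). Since the number of edges at least doubles at each step,
`k + 1` is `O(log N)` (`add_one_le_log_size`).

*Labels.* Subdivision halves distances: two midpoints at distance at most `2` in the finer graph have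
edges whose endpoints are at distance at most `2` in the coarser one
(`edist_le_two_of_subdivide_inr`). Hence, starting from one node, taking parents and keeping those on
one layer never produces a set of diameter more than `2` in the graph generated with that layer
(`Near.parents`), and such a set has at most `49` elements. The layers go down along a label, so it
has at most `k + 1` entries, each of bounded size (`labelWords_label_le`).

The working memory of the routing algorithm is linear in the stored data and the received label. The
one point that is not immediate is the length of a path read off from the predecessor table:
tentative distances increase strictly from the predecessor of a vertex to the vertex
(`Dijkstra.Inv`), so that such a path does not repeat a vertex (`IsReadPath.length_le`).
-/

namespace SphereNet

open SimpleGraph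

/-! ### Subdivision of graphs of bounded local complexity -/

/-- The local properties of a triangulated closed surface that keep degrees bounded under
subdivision: degree at most `6`, at most two triangles on each edge, no complete subgraph on four
vertices. The last one is what keeps the second one stable: if `a, b, c, d` were pairwise adjacent,
the midpoint of `{a, d}` would be a third common neighbour of the midpoints of `{a, b}` and
`{a, c}`. -/
structure IsTame {V : Type} (G : SimpleGraph V) : Prop where
  degree_le : ∀ v, (G.neighborSet v).ncard ≤ 6
  common_le : ∀ a b, G.Adj a b → (G.commonNeighbors a b).ncard ≤ 2
  no_K4 : ∀ a b c d, G.Adj a b → G.Adj a c → G.Adj a d → G.Adj b c → G.Adj b d → ¬ G.Adj c d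

section Subdivide

variable {V : Type} {G : SimpleGraph V}

open Classical in
/-- The midpoint of the edge `{a, b}` as a vertex of the subdivision, and `a` if there is no such
edge. -/
noncomputable def midpoint (G : SimpleGraph V) (a b : V) : V ⊕ G.edgeSet :=
  if h : G.Adj a b then .inr ⟨s(a, b), h⟩ else .inl a

theorem midpoint_eq {a b : V} (h : s(a, b) ∈ G.edgeSet) : midpoint G a b = .inr ⟨s(a, b), h⟩ :=
  dif_pos h

theorem subdivide_inl_inr {v : V} {e : G.edgeSet} :
    (subdivide G).Adj (.inl v) (.inr e) ↔ v ∈ e.1 := Iff.rfl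

theorem subdivide_inr_inl {v : V} {e : G.edgeSet} :
    (subdivide G).Adj (.inr e) (.inl v) ↔ v ∈ e.1 := Iff.rfl

theorem subdivide_inr_inr {e e' : G.edgeSet} :
    (subdivide G).Adj (.inr e) (.inr e') ↔
      ∃ a b c : V, e.1 = s(a, b) ∧ e'.1 = s(a, c) ∧ G.Adj b c := Iff.rfl

/-- The neighbours, among the midpoints, of the midpoint of `{a, b}`. -/
theorem subdivide_midpoint_inr {a b : V} {h : s(a, b) ∈ G.edgeSet} {e : G.edgeSet} :
    (subdivide G).Adj (.inr ⟨s(a, b), h⟩) (.inr e) ↔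
      ∃ c, G.Adj a c ∧ G.Adj b c ∧ (e.1 = s(a, c) ∨ e.1 = s(b, c)) := by
  rw [subdivide_inr_inr]
  constructor
  · rintro ⟨x, y, c, h1, h2, h3⟩
    have he := e.2
    rw [h2, mem_edgeSet] at he
    rcases Sym2.eq_iff.1 h1 with ⟨rfl, rfl⟩ | ⟨rfl, rfl⟩
    · exact ⟨c, he, h3, .inl h2⟩
    · exact ⟨c, h3, he, .inr h2⟩
  · rintro ⟨c, h1, h2, h3 | h3⟩
    · exact ⟨a, b, c, rfl, h3, h2⟩
    · exact ⟨b, a, c, Sym2.eq_swap, h3, h1⟩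

theorem subdivide_neighborSet_inl_subset (v : V) :
    (subdivide G).neighborSet (.inl v) ⊆ midpoint G v '' G.neighborSet v := by
  rintro (w | ⟨e, he⟩) h
  · exact False.elim h
  · obtain ⟨w, rfl⟩ := Sym2.mem_iff_exists.1 (subdivide_inl_inr.1 h)
    exact ⟨w, he, midpoint_eq he⟩

theorem subdivide_neighborSet_inr_subset {a b : V} (h : s(a, b) ∈ G.edgeSet) :
    (subdivide G).neighborSet (.inr ⟨s(a, b), h⟩) ⊆ {.inl a, .inl b} ∪
      (midpoint G a '' G.commonNeighbors a b ∪ midpoint G b '' G.commonNeighbors a b) := by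
  rintro (w | ⟨e, he⟩) hw
  · rcases Sym2.mem_iff.1 (subdivide_inr_inl.1 hw) with rfl | rfl <;> simp
  · obtain ⟨c, h1, h2, rfl | rfl⟩ := subdivide_midpoint_inr.1 hw
    · exact .inr (.inl ⟨c, ⟨h1, h2⟩, midpoint_eq he⟩)
    · exact .inr (.inr ⟨c, ⟨h1, h2⟩, midpoint_eq he⟩)

/-- Three midpoints that are pairwise adjacent are those of the sides of one triangle. Three edges
from one vertex are ruled out, as they would span a complete graph on four vertices. -/
theorem subdivide_triangle {e₁ e₂ e₃ : G.edgeSet} (hG : IsTame G)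
    (h12 : (subdivide G).Adj (.inr e₁) (.inr e₂)) (h13 : (subdivide G).Adj (.inr e₁) (.inr e₃))
    (h23 : (subdivide G).Adj (.inr e₂) (.inr e₃)) :
    ∃ a b c, e₁.1 = s(a, b) ∧ e₂.1 = s(a, c) ∧ e₃.1 = s(b, c) := by
  obtain ⟨a, b, c, h1, h2, hbc⟩ := subdivide_inr_inr.1 h12
  obtain ⟨e₁, he1⟩ := e₁
  obtain ⟨e₂, he2⟩ := e₂
  obtain ⟨e₃, he3⟩ := e₃
  subst h1 h2
  obtain ⟨d, had, hbd, hd⟩ := subdivide_midpoint_inr.1 h13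
  obtain ⟨f, haf, hcf, hf⟩ := subdivide_midpoint_inr.1 h23
  have hK := hG.no_K4 a b c d he1 he2 had hbc hbd
  have := had.ne
  have := hbd.ne
  have := haf.ne
  have := hcf.ne
  have := hbc.ne
  have := G.ne_of_adj he1
  have := G.ne_of_adj he2
  refine ⟨a, b, c, rfl, rfl, ?_⟩
  rcases hd with rfl | rfl <;> rcases hf with hf | hf <;>
    rcases Sym2.eq_iff.1 hf with ⟨h, h'⟩ | ⟨h, h'⟩ <;> grind

theorem IsTame.subdivide [Finite V] (hG : IsTame G) : IsTame (subdivide G) where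
  degree_le := by
    rintro (v | ⟨⟨a, b⟩, h⟩)
    · exact (Set.ncard_le_ncard (subdivide_neighborSet_inl_subset v)).trans
        ((Set.ncard_image_le (Set.toFinite _)).trans (hG.degree_le v))
    · refine (Set.ncard_le_ncard (subdivide_neighborSet_inr_subset h)).trans ?_
      have h0 := hG.common_le a b h
      have h1 := Set.ncard_union_le {.inl a, .inl b}
        (midpoint G a '' G.commonNeighbors a b ∪ midpoint G b '' G.commonNeighbors a b)
      have h2 := Set.ncard_union_le
        (midpoint G a '' G.commonNeighbors a b) (midpoint G b '' G.commonNeighbors a b)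
      have h3 := Set.ncard_image_le (f := midpoint G a) (G.commonNeighbors a b).toFinite
      have h4 := Set.ncard_image_le (f := midpoint G b) (G.commonNeighbors a b).toFinite
      have h5 : ({.inl a, .inl b} : Set (V ⊕ G.edgeSet)).ncard ≤ 2 :=
        (Set.ncard_insert_le _ _).trans (by rw [Set.ncard_singleton])
      omega
  common_le := by
    have key : ∀ (v : V) (e : G.edgeSet), v ∈ e.1 →
        ((SphereNet.subdivide G).commonNeighbors (.inl v) (.inr e)).ncard ≤ 2 := by
      rintro v ⟨e, he⟩ hv
      obtain ⟨w, rfl⟩ := Sym2.mem_iff_exists.1 hv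
      refine (Set.ncard_le_ncard (t := midpoint G v '' G.commonNeighbors v w) ?_).trans
        ((Set.ncard_image_le (Set.toFinite _)).trans (hG.common_le v w he))
      rintro (u | ⟨f, hf⟩) ⟨h1, h2⟩
      · exact False.elim h1
      · have hvf : v ∈ f := h1
        obtain ⟨c, hc, hc', rfl | rfl⟩ := subdivide_midpoint_inr.1 h2
        · exact ⟨c, ⟨hc, hc'⟩, midpoint_eq hf⟩
        · rcases Sym2.mem_iff.1 hvf with rfl | rfl
          · exact (G.loopless.irrefl _ he).elim
          · exact (G.loopless.irrefl _ hc).elim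
    rintro (v | e) (w | e') h
    · exact False.elim h
    · exact key v e' h
    · rw [commonNeighbors_symm]
      exact key w e h
    · obtain ⟨a, b, c, h1, h2, hbc⟩ := subdivide_inr_inr.1 h
      have hne : b ≠ c := hbc.ne
      refine (Set.ncard_le_ncard (t := {.inl a, midpoint G b c}) ?_).trans
        ((Set.ncard_insert_le _ _).trans (by rw [Set.ncard_singleton]))
      rintro (u | f) ⟨hf, hf'⟩
      · have hu : u ∈ e.1 := hf
        have hu' : u ∈ e'.1 := hf'
        rw [h1, Sym2.mem_iff] at hu
        rw [h2, Sym2.mem_iff] at hu'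
        left
        grind
      · right
        obtain ⟨x, y, z, hx, hy, hz⟩ := subdivide_triangle hG h hf hf'
        have hab := e.2
        have hac := e'.2
        rw [h1, mem_edgeSet] at hab
        rw [h2, mem_edgeSet] at hac
        have := hab.ne
        have := hac.ne
        have hfe : f.1 = s(b, c) := by
          rw [h1] at hx
          rw [h2] at hy
          rw [hz]
          rcases Sym2.eq_iff.1 hx with ⟨rfl, rfl⟩ | ⟨rfl, rfl⟩ <;>
            rcases Sym2.eq_iff.1 hy with ⟨h, h'⟩ | ⟨h, h'⟩ <;> grind
        obtain ⟨f, hf0⟩ := f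
        subst hfe
        exact (midpoint_eq hf0).symm
  no_K4 := by
    -- three midpoints that are pairwise adjacent have no common neighbour
    have key : ∀ (x : V ⊕ G.edgeSet) (e₁ e₂ e₃ : G.edgeSet),
        (SphereNet.subdivide G).Adj (.inr e₁) (.inr e₂) →
        (SphereNet.subdivide G).Adj (.inr e₁) (.inr e₃) →
        (SphereNet.subdivide G).Adj (.inr e₂) (.inr e₃) →
        (SphereNet.subdivide G).Adj x (.inr e₁) → (SphereNet.subdivide G).Adj x (.inr e₂) →
        ¬ (SphereNet.subdivide G).Adj x (.inr e₃) := by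
      intro x e₁ e₂ e₃ h12 h13 h23 hx1 hx2 hx3
      obtain ⟨a, b, c, h1, h2, h3⟩ := subdivide_triangle hG h12 h13 h23
      have hab := e₁.2
      have hac := e₂.2
      have hbc := e₃.2
      rw [h1, mem_edgeSet] at hab
      rw [h2, mem_edgeSet] at hac
      rw [h3, mem_edgeSet] at hbc
      have := hab.ne
      have := hac.ne
      have := hbc.ne
      rcases x with v | f
      · rw [subdivide_inl_inr, h1, Sym2.mem_iff] at hx1
        rw [subdivide_inl_inr, h2, Sym2.mem_iff] at hx2
        rw [subdivide_inl_inr, h3, Sym2.mem_iff] at hx3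
        grind
      · obtain ⟨x, y, z, hx, hy, hz⟩ := subdivide_triangle hG h12 hx1.symm hx2.symm
        have hfe : f.1 = e₃.1 := by
          rw [h1] at hx
          rw [h2] at hy
          rw [h3, hz]
          rcases Sym2.eq_iff.1 hx with ⟨rfl, rfl⟩ | ⟨rfl, rfl⟩ <;>
            rcases Sym2.eq_iff.1 hy with ⟨h, h'⟩ | ⟨h, h'⟩ <;> grind
        exact hx3.ne (congrArg Sum.inr (Subtype.ext hfe))
    rintro (a | a) (b | b) (c | c) (d | d) h1 h2 h3 h4 h5 h6
    all_goals first
      | exact False.elim h1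
      | exact False.elim h2
      | exact False.elim h3
      | exact False.elim h4
      | exact False.elim h5
      | exact False.elim h6
      | exact key _ _ _ _ h4 h5 h6 h1 h2 h3
      | exact key _ _ _ _ h2 h3 h6 h1.symm h4 h5
      | exact key _ _ _ _ h1 h3 h5 h2.symm h4.symm h6
      | exact key _ _ _ _ h1 h2 h4 h3.symm h5.symm h6.symm

/-- Both halves of each edge are edges of the subdivision. -/
theorem two_mul_card_edgeSet_le_subdivide [Finite V] :
    2 * Nat.card G.edgeSet ≤ Nat.card (subdivide G).edgeSet := by
  classical
  have := Fintype.ofFinite V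
  rw [Nat.card_eq_fintype_card, ← edgeFinset_card, ← G.dart_card_eq_twice_card_edges,
    ← Nat.card_eq_fintype_card]
  refine Nat.card_le_card_of_injective
    (fun d : G.Dart => (⟨s(.inl d.fst, .inr ⟨d.edge, d.edge_mem⟩),
      show d.fst ∈ d.edge from Sym2.mem_mk_left _ _⟩ : (subdivide G).edgeSet)) ?_
  rintro ⟨⟨a, b⟩, h⟩ ⟨⟨c, d⟩, h'⟩ hd
  have := h.ne
  simp [Dart.edge] at hd
  grind

/-- The distance from an old vertex `v` to the vertices of the subdivision, in steps of half an edge: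
twice the distance in `G` for an old vertex, the sum over the two endpoints for a midpoint. -/
noncomputable def halfDist (G : SimpleGraph V) (v : V) : V ⊕ G.edgeSet → ℕ∞ :=
  Sum.elim (fun u => G.edist v u + G.edist v u) fun e =>
    Sym2.lift ⟨fun a b => G.edist v a + G.edist v b, fun _ _ => add_comm _ _⟩ e.1

theorem halfDist_inr {v a b : V} {e : G.edgeSet} (h : e.1 = s(a, b)) :
    halfDist G v (.inr e) = G.edist v a + G.edist v b := by
  simp [halfDist, h]

theorem edist_le_edist_add_one {v a b : V} (h : G.Adj a b) : G.edist v b ≤ G.edist v a + 1 :=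
  (SimpleGraph.edist_triangle (v := a)).trans (add_le_add_right (edist_eq_one_iff_adj.2 h).le _)

theorem halfDist_le_of_adj (v : V) {x y : V ⊕ G.edgeSet} (h : (subdivide G).Adj x y) :
    halfDist G v y ≤ halfDist G v x + 1 := by
  rcases x with a | e <;> rcases y with b | e'
  · exact False.elim h
  · obtain ⟨b, hb⟩ := Sym2.mem_iff_exists.1 (subdivide_inl_inr.1 h)
    have he := e'.2
    rw [hb, mem_edgeSet] at he
    rw [halfDist_inr hb]
    calc _ ≤ G.edist v a + (G.edist v a + 1) := by gcongr; exact edist_le_edist_add_one he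
      _ = _ := (add_assoc _ _ _).symm
  · obtain ⟨a, ha⟩ := Sym2.mem_iff_exists.1 (subdivide_inr_inl.1 h)
    have he := e.2
    rw [ha, mem_edgeSet] at he
    rw [halfDist_inr ha]
    calc _ ≤ G.edist v b + (G.edist v a + 1) := by
          unfold halfDist; dsimp; gcongr; exact edist_le_edist_add_one he.symm
      _ = _ := (add_assoc _ _ _).symm
  · obtain ⟨a, b, c, h1, h2, h3⟩ := subdivide_inr_inr.1 h
    rw [halfDist_inr h1, halfDist_inr h2, add_assoc]
    gcongr
    exact edist_le_edist_add_one h3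

theorem le_add_edist_of_adj {W : Type} {H : SimpleGraph W} {f : W → ℕ∞}
    (hf : ∀ x y, H.Adj x y → f y ≤ f x + 1) (x y : W) : f y ≤ f x + H.edist x y := by
  have key : ∀ {x y : W} (p : H.Walk x y), f y ≤ f x + p.length := by
    intro x y p
    induction p with
    | nil => simp
    | cons h p ih =>
      refine ih.trans ?_
      rw [Walk.length_cons, Nat.cast_succ, add_comm (p.length : ℕ∞), ← add_assoc]
      gcongr
      exact hf _ _ h
  by_cases h : H.edist x y = ⊤
  · simp [h]
  · obtain ⟨p, hp⟩ := exists_walk_of_edist_ne_top h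
    exact hp ▸ key p

theorem edist_le_two_of_subdivide_inl {v w : V}
    (h : (subdivide G).edist (.inl v) (.inl w) ≤ 2) : G.edist v w ≤ 2 := by
  have h1 := le_add_edist_of_adj (fun x y => halfDist_le_of_adj (G := G) v) (.inl v) (.inl w)
  simp only [halfDist, Sum.elim_inl, edist_self, zero_add] at h1
  exact le_self_add.trans (h1.trans h)

/-- Distance at most `2` is passed on from midpoints to the endpoints of their edges. With
`e = {v, a}` and `e' = {w, b}`, the half-edge distances from `v` give `d(v, w) + d(v, b) ≤ 1 + 2`,
and `d(v, w) ≤ d(v, b) + 1`. -/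
theorem edist_le_two_of_subdivide_inr {e e' : G.edgeSet} {v w : V} (hv : v ∈ e.1) (hw : w ∈ e'.1)
    (h : (subdivide G).edist (.inr e) (.inr e') ≤ 2) : G.edist v w ≤ 2 := by
  obtain ⟨a, ha⟩ := Sym2.mem_iff_exists.1 hv
  obtain ⟨b, hb⟩ := Sym2.mem_iff_exists.1 hw
  have h1 := le_add_edist_of_adj (fun x y => halfDist_le_of_adj (G := G) v) (.inr e) (.inr e')
  have hva := e.2
  have hwb := e'.2
  rw [ha, mem_edgeSet] at hva
  rw [hb, mem_edgeSet] at hwb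
  rw [halfDist_inr ha, halfDist_inr hb, edist_self, edist_eq_one_iff_adj.2 hva, zero_add] at h1
  replace h1 : G.edist v w + G.edist v b ≤ 3 :=
    h1.trans ((add_le_add_right h 1).trans (by norm_num))
  have h2 := edist_le_edist_add_one (v := v) hwb.symm
  have hw' : G.edist v w ≠ ⊤ := fun h => by simp [h] at h1
  have hb' : G.edist v b ≠ ⊤ := fun h => by simp [h] at h1
  lift G.edist v w to ℕ using hw' with m
  lift G.edist v b to ℕ using hb' with n
  norm_cast at *
  omega

end Subdivide

/-! ### The icosahedron -/

/-- The edges of the icosahedron as a finite set, which makes adjacency computable. -/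
theorem icosahedron_adj (a b : Fin 12) : icosahedron.Adj a b ↔
    s(a, b) ∈ ({s(0, 1), s(0, 2), s(0, 3), s(0, 4), s(0, 5),
     s(1, 2), s(2, 3), s(3, 4), s(4, 5), s(5, 1),
     s(1, 6), s(2, 7), s(3, 8), s(4, 9), s(5, 10),
     s(1, 7), s(2, 8), s(3, 9), s(4, 10), s(5, 6),
     s(6, 7), s(7, 8), s(8, 9), s(9, 10), s(10, 6),
     s(11, 6), s(11, 7), s(11, 8), s(11, 9), s(11, 10)} : Finset (Sym2 (Fin 12))) ∧ a ≠ b := by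
  unfold icosahedron
  rw [fromEdgeSet_adj]
  simp only [Finset.mem_insert, Finset.mem_singleton, Set.mem_insert_iff, Set.mem_singleton_iff]

instance : DecidableRel icosahedron.Adj := fun a b => decidable_of_iff _ (icosahedron_adj a b).symm

set_option maxRecDepth 100000 in
theorem isTame_icosahedron : IsTame icosahedron where
  degree_le := by
    have : ∀ v, (icosahedron.neighborFinset v).card ≤ 6 := by decide
    intro v
    rw [Set.ncard_eq_toFinset_card']
    exact this v
  common_le := by
    have : ∀ a b, icosahedron.Adj a b → (icosahedron.commonNeighbors a b).toFinset.card ≤ 2 := by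
      decide
    intro a b h
    rw [Set.ncard_eq_toFinset_card']
    exact this a b h
  no_K4 := by
    have : ∀ a b, icosahedron.Adj a b → ∀ c, icosahedron.Adj a c → icosahedron.Adj b c →
        ∀ d, icosahedron.Adj a d → icosahedron.Adj b d → ¬ icosahedron.Adj c d := by
      decide
    exact fun a b c d h1 h2 h3 h4 h5 => this a b h1 c h2 h4 d h3 h5

set_option maxRecDepth 100000 in
theorem card_edgeSet_icosahedron : Nat.card icosahedron.edgeSet = 30 := by
  rw [Nat.card_eq_fintype_card, ← edgeFinset_card]
  decide

/-! ### Balls in graphs of bounded degree -/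

theorem ncard_edist_le_le_pow {V : Type} [Finite V] (H : SimpleGraph V) {m : ℕ}
    (hm : ∀ v, (H.neighborSet v).ncard ≤ m) (v : V) (r : ℕ) :
    {w | H.edist v w ≤ r}.ncard ≤ (m + 1) ^ r := by
  classical
  have := Fintype.ofFinite V
  induction r with
  | zero => simp
  | succ r ih =>
    have hsub : {w | H.edist v w ≤ (r + 1 : ℕ)} ⊆
        ({w | H.edist v w ≤ r}.toFinset.biUnion
          fun u => insert u (H.neighborFinset u) : Finset V) := by
      intro w hw
      simp only [Finset.coe_biUnion, Set.mem_iUnion, Finset.coe_insert, coe_neighborFinset,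
        Set.mem_insert_iff, mem_neighborSet, Finset.mem_coe, Set.mem_toFinset, Set.mem_ofPred_eq,
        exists_prop] at hw ⊢
      have htop : H.edist v w ≠ ⊤ := fun h => by
        rw [h, top_le_iff] at hw
        exact ENat.natCast_ne_top _ hw
      obtain ⟨p, hp⟩ := exists_walk_of_edist_ne_top htop
      rw [← hp, Nat.cast_le] at hw
      -- drop the last edge of a shortest walk, which is the first one of its reverse
      have hlen := p.reverse.length_reverse
      rw [Walk.reverse_reverse] at hlen
      generalize p.reverse = q at hlen
      cases q with
      | nil => exact ⟨v, by simp, .inl rfl⟩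
      | @cons _ u _ h q =>
        refine ⟨u, q.reverse.edist_le.trans ?_, .inr h.symm⟩
        rw [Walk.length_cons] at hlen
        rw [Walk.length_reverse, Nat.cast_le]
        omega
    refine (Set.ncard_le_ncard hsub).trans ?_
    rw [Set.ncard_coe_finset, pow_succ]
    refine (Finset.card_biUnion_le_card_mul _ _ (m + 1) fun u _ => ?_).trans ?_
    · refine (Finset.card_insert_le _ _).trans (Nat.succ_le_succ ?_)
      rw [← Set.ncard_coe_finset, coe_neighborFinset]
      exact hm u
    · rw [← Set.ncard_eq_toFinset_card']
      gcongr

/-! ### Size, layers and degrees of the network -/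

theorem isTame_fine : ∀ k, IsTame (network k).fine
  | 0 => isTame_icosahedron
  | k + 1 => (isTame_fine k).subdivide

theorem le_card_edgeSet_fine : ∀ k, 30 * 2 ^ k ≤ Nat.card (network k).fine.edgeSet
  | 0 => card_edgeSet_icosahedron.ge
  | k + 1 => by
    have h1 := le_card_edgeSet_fine k
    have h2 : 2 * Nat.card (network k).fine.edgeSet ≤ Nat.card (network (k + 1)).fine.edgeSet :=
      two_mul_card_edgeSet_le_subdivide
    rw [pow_succ]
    omega

theorem two_pow_le_size (k : ℕ) : 2 ^ (k + 2) ≤ (network k).size := by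
  rw [Network.size, ← Nat.card_eq_fintype_card]
  cases k with
  | zero =>
    change 2 ^ 2 ≤ Nat.card (Fin 12)
    simp
  | succ k =>
    change 2 ^ (k + 1 + 2) ≤ Nat.card ((network k).Node ⊕ (network k).fine.edgeSet)
    rw [Nat.card_sum]
    have := le_card_edgeSet_fine k
    rw [pow_add, pow_succ]
    omega

theorem add_one_le_log_size (k : ℕ) : (k + 1 : ℝ) ≤ 2 * Real.log (network k).size := by
  have h : ((2 : ℝ) ^ (k + 2)) ≤ (network k).size := by exact_mod_cast two_pow_le_size k
  have h1 := Real.log_le_log (by positivity) h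
  rw [Real.log_pow] at h1
  have h2 := Real.log_two_gt_d9
  push_cast at h1
  nlinarith

theorem layer_le : ∀ (k : ℕ) (a : (network k).Node), (network k).layer a ≤ k
  | 0, _ => le_rfl
  | k + 1, .inl v => (layer_le k v).trans k.le_succ
  | _ + 1, .inr _ => le_rfl

section Successor

variable {k : ℕ}

theorem graph_succ_inl_inl {v w : (network k).Node} :
    (network (k + 1)).graph.Adj (.inl v) (.inl w) ↔ (network k).graph.Adj v w := by
  exact (sup_adj ((network k).graph.map Function.Embedding.inl) (subdivide (network k).fine)
    _ _).trans ((or_iff_left id).trans (map_adj_apply (f := Function.Embedding.inl)))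

theorem graph_succ_inr {e : (network k).fine.edgeSet} {x : (network (k + 1)).Node} :
    (network (k + 1)).graph.Adj (.inr e) x ↔ (network (k + 1)).fine.Adj (.inr e) x := by
  refine (sup_adj ((network k).graph.map Function.Embedding.inl) (subdivide (network k).fine)
    _ _).trans (or_iff_right ?_)
  rintro ⟨-, a, b, -, h, -⟩
  cases h

theorem graph_succ_inl_inr {v : (network k).Node} {e : (network k).fine.edgeSet} :
    (network (k + 1)).graph.Adj (.inl v) (.inr e) ↔ (network (k + 1)).fine.Adj (.inl v) (.inr e) :=
  (adj_comm _ _ _).trans (graph_succ_inr.trans (adj_comm _ _ _))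

end Successor

/-- Each subdivision gives a node at most six new neighbours. -/
theorem ncard_neighborSet_graph_le :
    ∀ (k : ℕ) (a : (network k).Node), ((network k).graph.neighborSet a).ncard ≤ 6 * (k + 1)
  | 0, a => isTame_icosahedron.degree_le a
  | k + 1, .inl v => by
    have hsub : (network (k + 1)).graph.neighborSet (.inl v) ⊆
        Sum.inl '' (network k).graph.neighborSet v ∪ (network (k + 1)).fine.neighborSet (.inl v) := by
      rintro (w | e) h
      · exact .inl ⟨w, graph_succ_inl_inl.1 h, rfl⟩
      · exact .inr (graph_succ_inl_inr.1 h)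
    exact (Set.ncard_le_ncard hsub (Set.toFinite _)).trans <| (Set.ncard_union_le _ _).trans <|
      (add_le_add ((Set.ncard_image_le (Set.toFinite _)).trans (ncard_neighborSet_graph_le k v))
        ((isTame_fine (k + 1)).degree_le (.inl v))).trans (by omega)
  | k + 1, .inr e => by
    have h : (network (k + 1)).graph.neighborSet (.inr e) =
        (network (k + 1)).fine.neighborSet (.inr e) := Set.ext fun _ => graph_succ_inr
    have h3 := (isTame_fine (k + 1)).degree_le (.inr e)
    rw [h]
    omega

/-- A node has at most six neighbours that are not on a higher layer: the corresponding edges were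
generated together with the node. -/
theorem ncard_adj_layer_le_le : ∀ (k : ℕ) (a : (network k).Node),
    {b | (network k).graph.Adj a b ∧ (network k).layer b ≤ (network k).layer a}.ncard ≤ 6
  | 0, a => (Set.ncard_le_ncard (fun _ h => h.1) (Set.toFinite _)).trans
      (isTame_icosahedron.degree_le a)
  | k + 1, .inl v => by
    refine (Set.ncard_le_ncard (t := Sum.inl ''
      {w | (network k).graph.Adj v w ∧ (network k).layer w ≤ (network k).layer v}) ?_
      (Set.toFinite _)).trans ((Set.ncard_image_le (Set.toFinite _)).trans (ncard_adj_layer_le_le k v))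
    rintro (w | e) ⟨h, hl⟩
    · exact ⟨w, ⟨graph_succ_inl_inl.1 h, hl⟩, rfl⟩
    · have h1 : k + 1 ≤ (network k).layer v := hl
      have := layer_le k v
      omega
  | k + 1, .inr e => (Set.ncard_le_ncard (fun _ h => graph_succ_inr.1 h.1) (Set.toFinite _)).trans
      ((isTame_fine (k + 1)).degree_le (.inr e))

theorem card_nbhd_le (k : ℕ) (a : (network k).Node) :
    ((network k).nbhd a).card ≤ (7 * (k + 1)) ^ 6 := by
  have h := ncard_edist_le_le_pow (network k).graph (ncard_neighborSet_graph_le k) a 6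
  rw [← Set.ncard_coe_finset]
  have hs : (((network k).nbhd a : Finset _) : Set (network k).Node) =
      {w | (network k).graph.edist a w ≤ (6 : ℕ)} := by
    ext w
    simp [Network.nbhd]
  rw [hs]
  exact h.trans (Nat.pow_le_pow_left (by omega) 6)

theorem card_nbhdEdges_le (k : ℕ) (a : (network k).Node) :
    ((network k).nbhdEdges a).card ≤ 6 * ((network k).nbhd a).card := by
  classical
  -- each edge is charged to an endpoint on the higher of the layers of its two endpoints
  have hsub : (network k).nbhdEdges a ⊆ ((network k).nbhd a).biUnion fun v =>
      {b | (network k).graph.Adj v b ∧ (network k).layer b ≤ (network k).layer v}.toFinset.image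
        fun b => s(v, b) := by
    rintro ⟨x, y⟩ he
    obtain ⟨-, hadj, hmem⟩ := Finset.mem_filter.1 he
    simp only [Finset.mem_biUnion, Finset.mem_image, Set.mem_toFinset, Set.mem_ofPred_eq]
    rcases le_total ((network k).layer y) ((network k).layer x) with h | h
    · exact ⟨x, hmem x (Sym2.mem_mk_left _ _), y, ⟨hadj, h⟩, rfl⟩
    · exact ⟨y, hmem y (Sym2.mem_mk_right _ _), x, ⟨hadj.symm, h⟩, Sym2.eq_swap⟩
  refine (Finset.card_le_card hsub).trans ?_
  rw [mul_comm]
  refine Finset.card_biUnion_le_card_mul _ _ 6 fun v _ => Finset.card_image_le.trans ?_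
  rw [← Set.ncard_eq_toFinset_card']
  exact ncard_adj_layer_le_le k v

/-! ### Labels -/

/-- Two nodes of the network are near if they are on the same layer `i` and their distance in the
graph of the edges generated with that layer is at most `2`; on layer `0` all nodes are near. -/
def Near : (k : ℕ) → (network k).Node → (network k).Node → Prop
  | 0, _, _ => True
  | k + 1, .inl v, .inl w => Near k v w
  | _ + 1, .inl _, .inr _ => False
  | _ + 1, .inr _, .inl _ => False
  | k + 1, .inr e, .inr e' => (subdivide (network k).fine).edist (.inr e) (.inr e') ≤ 2

theorem Near.refl : ∀ (k : ℕ) (a : (network k).Node), Near k a a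
  | 0, _ => trivial
  | k + 1, .inl v => Near.refl k v
  | _ + 1, .inr e => by
    change (subdivide _).edist (.inr e) (.inr e) ≤ 2
    simp

theorem near_of_edist_le : ∀ (k : ℕ) (a b : (network k).Node),
    (network k).layer a = (network k).layer b → (network k).fine.edist a b ≤ 2 → Near k a b
  | 0, _, _, _, _ => trivial
  | k + 1, .inl v, .inl w, hl, h => near_of_edist_le k v w hl (edist_le_two_of_subdivide_inl h)
  | k + 1, .inl v, .inr _, hl, _ => by
    have h1 : (network k).layer v = k + 1 := hl
    have := layer_le k v
    omega
  | k + 1, .inr _, .inl v, hl, _ => by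
    have h1 : k + 1 = (network k).layer v := hl
    have := layer_le k v
    omega
  | _ + 1, .inr _, .inr _, _, h => h

/-- The bound is `(6 + 1) ^ 2`, for a ball of radius `2` in a graph of degree at most `6`. -/
theorem ncard_near_le : ∀ (k : ℕ) (a : (network k).Node), {b | Near k a b}.ncard ≤ 49
  | 0, _ => (Set.ncard_le_card _).trans (by
      change Nat.card (Fin 12) ≤ 49
      simp)
  | k + 1, .inl v => by
    refine (Set.ncard_le_ncard (t := Sum.inl '' {w | Near k v w}) ?_
      (Set.toFinite _)).trans ((Set.ncard_image_le (Set.toFinite _)).trans (ncard_near_le k v))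
    rintro (w | e) h
    · exact ⟨w, h, rfl⟩
    · exact False.elim h
  | k + 1, .inr e => by
    refine (Set.ncard_le_ncard (t := {w | (network (k + 1)).fine.edist (.inr e) w ≤ (2 : ℕ)}) ?_
      (Set.toFinite _)).trans
      (ncard_edist_le_le_pow _ (isTame_fine (k + 1)).degree_le (.inr e) 2)
    rintro (w | e') h
    · exact False.elim h
    · exact h

theorem mem_parents {S : Network} {a b : S.Node} :
    b ∈ S.parents a ↔ S.graph.Adj a b ∧ S.layer b < S.layer a := by
  simp [Network.parents]

theorem mem_parents_succ_inl {k : ℕ} {v : (network k).Node} {x : (network (k + 1)).Node}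
    (h : x ∈ (network (k + 1)).parents (.inl v)) : ∃ w ∈ (network k).parents v, x = .inl w := by
  obtain ⟨hadj, hl⟩ := mem_parents.1 h
  rcases x with w | e
  · exact ⟨w, mem_parents.2 ⟨graph_succ_inl_inl.1 hadj, hl⟩, rfl⟩
  · have h1 : k + 1 < (network k).layer v := hl
    have := layer_le k v
    omega

theorem mem_parents_succ_inr {k : ℕ} {e : (network k).fine.edgeSet} {x : (network (k + 1)).Node}
    (h : x ∈ (network (k + 1)).parents (.inr e)) : ∃ w ∈ e.1, x = .inl w := by
  obtain ⟨hadj, hl⟩ := mem_parents.1 h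
  rcases x with w | e'
  · exact ⟨w, subdivide_inr_inl.1 (graph_succ_inr.1 hadj), rfl⟩
  · exact (lt_irrefl _ hl).elim

/-- Nearness is inherited by parents on a common layer: passing to the endpoints of the edges halves
distances up to a constant, and `2` is preserved. -/
theorem Near.parents : ∀ {k : ℕ} {a b x y : (network k).Node}, Near k a b →
    x ∈ (network k).parents a → y ∈ (network k).parents b →
    (network k).layer x = (network k).layer y → Near k x y
  | 0, _, _, _, _, _, _, _, _ => trivial
  | k + 1, .inl v, .inl w, _, _, h, hx, hy, hl => by
    obtain ⟨x, hx', rfl⟩ := mem_parents_succ_inl hx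
    obtain ⟨y, hy', rfl⟩ := mem_parents_succ_inl hy
    exact Near.parents (k := k) h hx' hy' hl
  | _ + 1, .inl _, .inr _, _, _, h, _, _, _ => h.elim
  | _ + 1, .inr _, .inl _, _, _, h, _, _, _ => h.elim
  | k + 1, .inr e, .inr e', _, _, h, hx, hy, hl => by
    obtain ⟨x, hx', rfl⟩ := mem_parents_succ_inr hx
    obtain ⟨y, hy', rfl⟩ := mem_parents_succ_inr hy
    exact near_of_edist_le k x y hl (edist_le_two_of_subdivide_inr hx' hy' h)

theorem labelFilter_subset_goodParents (S : Network) (A : Finset S.Node) :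
    S.labelFilter A ⊆ S.goodParents A := by
  unfold Network.labelFilter
  split_ifs
  · exact subset_rfl
  · exact Finset.filter_subset _ _

theorem near_labelFilter {k : ℕ} {A : Finset (network k).Node}
    (hA : ∀ a ∈ A, ∀ b ∈ A, Near k a b) :
    ∀ a ∈ (network k).labelFilter A, ∀ b ∈ (network k).labelFilter A, Near k a b := by
  intro x hx y hy
  obtain ⟨hx, hx'⟩ := Finset.mem_filter.1 (labelFilter_subset_goodParents _ A hx)
  obtain ⟨hy, hy'⟩ := Finset.mem_filter.1 (labelFilter_subset_goodParents _ A hy)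
  obtain ⟨a, ha, hxa⟩ := Finset.mem_biUnion.1 hx
  obtain ⟨b, hb, hyb⟩ := Finset.mem_biUnion.1 hy
  exact (hA a ha b hb).parents hxa hyb (le_antisymm (hx' y hy) (hy' x hx))

/-- Each entry costs at most `49 + 1` words, and the highest layer drops from each entry to the
next. -/
theorem labelWords_labelFrom_le {k : ℕ} (A : Finset (network k).Node)
    (hA : ∀ a ∈ A, ∀ b ∈ A, Near k a b) :
    labelWords ((network k).labelFrom A) ≤ 50 * (A.sup (network k).layer + 1) := by
  have hcard : A.card ≤ 49 := by
    rcases A.eq_empty_or_nonempty with rfl | ⟨a, ha⟩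
    · simp
    · rw [← Set.ncard_coe_finset]
      exact (Set.ncard_le_ncard (hA a ha) (Set.toFinite _)).trans (ncard_near_le k a)
  induction hn : A.sup (network k).layer using Nat.strong_induction_on generalizing A with
  | _ n ih =>
  rw [Network.labelFrom]
  split_ifs with h
  · simp [labelWords]
    omega
  · push Not at h
    obtain ⟨⟨a, ha⟩, h0⟩ := h
    have hpos : 0 < A.sup (network k).layer :=
      (Nat.pos_of_ne_zero (h0 a ha)).trans_le (Finset.le_sup ha)
    have hlt : ((network k).labelFilter A).sup (network k).layer < A.sup (network k).layer := by
      refine (Finset.sup_lt_iff hpos).2 fun b hb => ?_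
      obtain ⟨c, hc, hbc⟩ := Finset.mem_biUnion.1 ((network k).labelFilter_subset A hb)
      exact (mem_parents.1 hbc).2.trans_le (Finset.le_sup hc)
    have hB := near_labelFilter hA
    have hcardB : ((network k).labelFilter A).card ≤ 49 := by
      rcases ((network k).labelFilter A).eq_empty_or_nonempty with h | ⟨b, hb⟩
      · simp [h]
      · rw [← Set.ncard_coe_finset]
        exact (Set.ncard_le_ncard (hB b hb) (Set.toFinite _)).trans (ncard_near_le k b)
    have := ih _ (hn ▸ hlt) _ hB hcardB rfl
    simp only [labelWords, List.map_cons, List.sum_cons] at this ⊢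
    omega

theorem labelWords_label_le (k : ℕ) (a : (network k).Node) :
    labelWords ((network k).label a) ≤ 50 * (k + 1) := by
  refine (labelWords_labelFrom_le {a} ?_).trans ?_
  · simpa using Near.refl k a
  · simpa using layer_le k a

/-! ### Working memory of the routing algorithm -/

section Routing

variable {V : Type}

/-- The tables of Dijkstra's algorithm only concern stored vertices, and tentative distances strictly
increase from the predecessor of a vertex to the vertex. -/
structure Dijkstra.Inv (M : LocalData V) (D : Dijkstra V) : Prop where
  queue_subset : D.queue ⊆ M.nbhd
  mem_of_dist : ∀ v d, D.dist v = some d → v ∈ M.nbhd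
  pred_lt : ∀ v u, D.pred v = some u → ∃ du dv, D.dist u = some du ∧ D.dist v = some dv ∧ du < dv

theorem Dijkstra.inv_start [DecidableEq V] {M : LocalData V} (hM : M.self ∈ M.nbhd) (t : V) :
    (Dijkstra.start M t).Inv M where
  queue_subset := subset_rfl
  mem_of_dist := by
    intro v d h
    by_cases hv : v = M.self
    · exact hv ▸ hM
    · simp [Dijkstra.start, hv] at h
  pred_lt := by simp [Dijkstra.start]

theorem Dijkstra.Inv.settle [DecidableEq V] {M : LocalData V} {D : Dijkstra V} (h : D.Inv M) (u : V) :
    (D.settle u).Inv M where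
  queue_subset := (Finset.erase_subset _ _).trans h.queue_subset
  mem_of_dist := h.mem_of_dist
  pred_lt := h.pred_lt

/-- Relaxing a link lowers a tentative distance, which keeps it below the distances of the vertices
that have the relaxed one as predecessor. -/
theorem Dijkstra.Inv.relax [DecidableEq V] {M : LocalData V} {D : Dijkstra V} (h : D.Inv M)
    (u : V) {v : V} (hv : v ∈ M.nbhd) : (D.relax u v).Inv M := by
  unfold Dijkstra.relax
  split_ifs with hi
  · obtain ⟨d, hd, hmin⟩ := hi
    have huv : u ≠ v := by
      rintro rfl
      have := hmin d hd
      omega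
    refine ⟨h.queue_subset, fun w e hw => ?_, fun w x hx => ?_⟩
    · by_cases hwv : w = v
      · exact hwv ▸ hv
      · exact h.mem_of_dist w e (by simpa [hwv] using hw)
    · by_cases hwv : w = v
      · subst hwv
        obtain rfl : u = x := by simpa using hx
        exact ⟨d, d + 1, by simpa [huv] using hd, by simp [hd], d.lt_succ_self⟩
      · obtain ⟨dx, dw, h1, h2, h3⟩ := h.pred_lt w x (by simpa [hwv] using hx)
        by_cases hxv : x = v
        · subst hxv
          exact ⟨d + 1, dw, by simp [hd], by simpa [hwv] using h2, (hmin dx h1).trans h3⟩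
        · exact ⟨dx, dw, by simpa [hxv] using h1, by simpa [hwv] using h2, h3⟩
  · exact h

theorem Dijkstra.Inv.words_le [Fintype V] {M : LocalData V} {D : Dijkstra V} (h : D.Inv M) :
    D.words ≤ 1 + 5 * M.nbhd.card := by
  have h1 := Finset.card_le_card h.queue_subset
  have h2 : (Finset.univ.filter fun v => (D.dist v).isSome).card ≤ M.nbhd.card := by
    refine Finset.card_le_card fun v hv => ?_
    obtain ⟨d, hd⟩ := Option.isSome_iff_exists.1 (Finset.mem_filter.1 hv).2
    exact h.mem_of_dist v d hd
  have h3 : (Finset.univ.filter fun v => (D.pred v).isSome).card ≤ M.nbhd.card := by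
    refine Finset.card_le_card fun v hv => ?_
    obtain ⟨u, hu⟩ := Option.isSome_iff_exists.1 (Finset.mem_filter.1 hv).2
    obtain ⟨-, d, -, hd, -⟩ := h.pred_lt v u hu
    exact h.mem_of_dist v d hd
  unfold Dijkstra.words
  omega

/-- The list `P` is the end of a path that has been read off from the predecessor table: it runs
through stored vertices, and tentative distances increase along it. -/
def IsReadPath (M : LocalData V) (D : Dijkstra V) (P : List V) : Prop :=
  (∀ v ∈ P, v ∈ M.nbhd) ∧ P.Pairwise fun v w => (D.dist v).getD 0 < (D.dist w).getD 0

theorem IsReadPath.length_le {M : LocalData V} {D : Dijkstra V} {P : List V}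
    (h : IsReadPath M D P) : P.length ≤ M.nbhd.card := by
  have hnd : P.Nodup := h.2.imp fun hlt heq => by simp [heq] at hlt
  classical
  rw [← List.toFinset_card_of_nodup hnd]
  exact Finset.card_le_card fun v hv => h.1 v (List.mem_toFinset.1 hv)

theorem IsReadPath.cons {M : LocalData V} {D : Dijkstra V} (hD : D.Inv M) {u v : V} {P : List V}
    (h : IsReadPath M D (v :: P)) (hu : D.pred v = some u) : IsReadPath M D (u :: v :: P) := by
  obtain ⟨du, dv, h1, h2, h3⟩ := hD.pred_lt v u hu
  have huv : (D.dist u).getD 0 < (D.dist v).getD 0 := by simpa [h1, h2] using h3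
  refine ⟨List.forall_mem_cons.2 ⟨hD.mem_of_dist u du h1, h.1⟩, List.pairwise_cons.2 ⟨?_, h.2⟩⟩
  exact List.forall_mem_cons.2 ⟨huv, fun w hw => huv.trans (List.rel_of_pairwise_cons h.2 hw)⟩

/-- What holds of the working memory at every moment of a run. -/
def Work.Inv (M : LocalData V) (lb : List (Finset V)) : Work V → Prop
  | start => True
  | scan _ => True
  | pick A => A.card ≤ labelWords lb + labelWords M.label
  | gather j L => L.card ≤ labelWords (lb.take j)
  | meet L I => L.card ≤ labelWords lb ∧ I ⊆ M.nbhd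
  | loop I best => I ⊆ M.nbhd ∧ pathWords best ≤ M.nbhd.card
  | search I best D => I ⊆ M.nbhd ∧ pathWords best ≤ M.nbhd.card ∧ D.Inv M
  | relax I best D _ R => I ⊆ M.nbhd ∧ pathWords best ≤ M.nbhd.card ∧ D.Inv M ∧ R ⊆ M.nbhd
  | readPath I best D P => I ⊆ M.nbhd ∧ pathWords best ≤ M.nbhd.card ∧ D.Inv M ∧ IsReadPath M D P
  | halt P => P.length ≤ M.nbhd.card + 1

theorem labelWords_append (l l' : List (Finset V)) :
    labelWords (l ++ l') = labelWords l + labelWords l' := by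
  simp [labelWords]

theorem card_le_labelWords {l : List (Finset V)} {i : ℕ} {A : Finset V}
    (h : l[i]? = some A) : A.card ≤ labelWords l := by
  have h1 : A.card + 1 ∈ l.map fun A => A.card + 1 :=
    List.mem_map.2 ⟨A, List.mem_of_getElem? h, rfl⟩
  exact (Nat.le_succ _).trans (List.le_sum_of_mem h1)

theorem Step.inv [DecidableEq V] {M : LocalData V} (hM : M.self ∈ M.nbhd)
    {lb : List (Finset V)} {w w' : Work V} (h : Step M lb w w') (hw : w.Inv M lb) : w'.Inv M lb := by
  have hpos : 0 < M.nbhd.card := Finset.card_pos.2 ⟨_, hM⟩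
  cases h with
  | arrived => simp [Work.Inv]
  | notArrived => trivial
  | found i A B _ _ hB =>
    have h1 := card_le_labelWords hB
    have h2 := Finset.card_le_card (Finset.inter_subset_left (s₁ := B) (s₂ := M.neighbors M.self))
    dsimp only [Work.Inv]
    omega
  | notFound => trivial
  | notInLabel => simp [Work.Inv]
  | gather j A L hA =>
    have h1 := Finset.card_union_le L A
    dsimp only [Work.Inv] at hw ⊢
    rw [List.take_add_one, hA, labelWords_append]
    simp only [labelWords, Option.toList_some, List.map_cons, List.map_nil, List.sum_cons,
      List.sum_nil] at hw ⊢
    omega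
  | gathered j L hj =>
    dsimp only [Work.Inv] at hw ⊢
    rw [List.take_of_length_le (List.getElem?_eq_none_iff.1 hj)] at hw
    exact ⟨hw, Finset.inter_subset_right⟩
  | far L A hA => exact (card_le_labelWords hA).trans le_add_self
  | near => exact ⟨hw.2, Nat.zero_le _⟩
  | pick A c =>
    dsimp only [Work.Inv, List.length]
    omega
  | target I best c => exact ⟨(Finset.erase_subset _ _).trans hw.1, hw.2, Dijkstra.inv_start hM c⟩
  | settle I best D u =>
    refine ⟨hw.1, hw.2.1, hw.2.2.settle u, ?_⟩
    exact Finset.inter_subset_left.trans (hw.2.2.settle u).queue_subset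
  | relax I best D u v R hv =>
    exact ⟨hw.1, hw.2.1, hw.2.2.1.relax u (hw.2.2.2 hv),
      (Finset.erase_subset _ _).trans hw.2.2.2⟩
  | relaxed => exact ⟨hw.1, hw.2.1, hw.2.2.1⟩
  | reached I best D ht =>
    refine ⟨hw.1, hw.2.1, hw.2.2, ?_, List.pairwise_singleton _ _⟩
    simpa using hw.2.2.queue_subset ht.1
  | readBack I best D u v P _ hu => exact ⟨hw.1, hw.2.1, hw.2.2.1, hw.2.2.2.cons hw.2.2.1 hu⟩
  | compare I best D P =>
    have h1 := hw.2.2.2.length_le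
    have h2 := hw.2.1
    refine ⟨hw.1, ?_⟩
    unfold shorter
    split
    · exact h1
    · split_ifs
      · exact h1
      · exact h2
  | finish P => exact (hw.2 : P.length ≤ _).trans (Nat.le_succ _)

theorem labelWords_take_le (l : List (Finset V)) (j : ℕ) :
    labelWords (l.take j) ≤ labelWords l := by
  conv_rhs => rw [← List.take_append_drop j l, labelWords_append]
  exact Nat.le_add_right _ _

theorem Work.Inv.words_le [Fintype V] {M : LocalData V} {lb : List (Finset V)} {w : Work V}
    (h : w.Inv M lb) :
    w.words ≤ labelWords lb + labelWords M.label + 8 * M.nbhd.card + 2 := by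
  cases w with
  | start => exact Nat.zero_le _
  | scan => simp only [Work.words]; omega
  | pick A => simp only [Work.words, Work.Inv] at *; omega
  | gather j L =>
    have := labelWords_take_le lb j
    simp only [Work.words, Work.Inv] at *
    omega
  | meet L I =>
    have := Finset.card_le_card h.2
    have := h.1
    simp only [Work.words]
    omega
  | loop I best =>
    have := Finset.card_le_card h.1
    have := h.2
    simp only [Work.words]
    omega
  | search I best D =>
    have := Finset.card_le_card h.1
    have := h.2.1
    have := h.2.2.words_le
    simp only [Work.words]
    omega
  | relax I best D u R =>
    have := Finset.card_le_card h.1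
    have := h.2.1
    have := h.2.2.1.words_le
    have := Finset.card_le_card h.2.2.2
    simp only [Work.words]
    omega
  | readPath I best D P =>
    have := Finset.card_le_card h.1
    have := h.2.1
    have := h.2.2.1.words_le
    have := h.2.2.2.length_le
    simp only [Work.words]
    omega
  | halt P => simp only [Work.words, Work.Inv] at *; omega

end Routing

theorem Network.Occurs.inv {S : Network} {a b : S.Node} {w : Work S.Node} (h : S.Occurs a b w) :
    w.Inv (S.localData a) (S.label b) := by
  have hself : a ∈ S.nbhd a := by simp [Network.nbhd]
  induction h with
  | refl => trivial
  | tail _ hstep ih => exact hstep.inv hself ih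

theorem memory_le {k : ℕ} {a b : (network k).Node} {w : Work (network k).Node}
    (h : (network k).Occurs a b w) :
    (network k).memory a b w ≤ 21 * (7 * (k + 1)) ^ 6 + 200 * (k + 1) + 4 := by
  have h1 : w.words ≤ labelWords ((network k).label b) + labelWords ((network k).label a)
    + 8 * ((network k).nbhd a).card + 2 := h.inv.words_le
  have h2 := card_nbhdEdges_le k a
  have h3 := card_nbhd_le k a
  have h4 := labelWords_label_le k a
  have h5 := labelWords_label_le k b
  simp only [Network.memory, Network.localData, LocalData.words]
  omega

end SphereNet

theorem mainTheorem11 :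
    ∃ C : ℝ,
      (∀ (k : ℕ) (a : (SphereNet.network k).Node),
        (SphereNet.labelWords ((SphereNet.network k).label a) : ℝ)
          ≤ C * Real.log (SphereNet.network k).size) ∧
      (∀ k : ℕ, 1 ≤ k → ∀ a : (SphereNet.network k).Node,
        (((SphereNet.network k).nbhd a).card : ℝ) ≤ C * (k : ℝ) ^ 6) ∧
      (∀ (k : ℕ) (a b : (SphereNet.network k).Node)
        (w : SphereNet.Work (SphereNet.network k).Node),
        (SphereNet.network k).Occurs a b w →
          ((SphereNet.network k).memory a b w : ℝ)
            ≤ C * Real.log (SphereNet.network k).size ^ 6) := by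
  -- `14 ^ 6` comes from `7 * (k + 1) ≤ 14 * k` and from `k + 1 ≤ 2 * log N`; the factor `22` leaves
  -- room for the labels
  refine ⟨22 * 14 ^ 6, fun k a => ?_, fun k hk a => ?_, fun k a b w hw => ?_⟩
  · have h1 : (SphereNet.labelWords ((SphereNet.network k).label a) : ℝ) ≤ 50 * (k + 1) := by
      exact_mod_cast SphereNet.labelWords_label_le k a
    have h2 := SphereNet.add_one_le_log_size k
    have h3 : (0 : ℝ) ≤ k := k.cast_nonneg
    linarith
  · have h1 : (((SphereNet.network k).nbhd a).card : ℝ) ≤ (7 * (k + 1)) ^ 6 := by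
      exact_mod_cast SphereNet.card_nbhd_le k a
    have h2 : (1 : ℝ) ≤ k := by exact_mod_cast hk
    have h3 : (7 * (k + 1) : ℝ) ^ 6 ≤ (14 * k) ^ 6 :=
      pow_le_pow_left₀ (by positivity) (by linarith) 6
    have h4 : (0 : ℝ) ≤ (k : ℝ) ^ 6 := by positivity
    rw [mul_pow 14] at h3
    linarith
  · have h1 : ((SphereNet.network k).memory a b w : ℝ) ≤
        21 * (7 * (k + 1)) ^ 6 + 200 * (k + 1) + 4 := by
      exact_mod_cast SphereNet.memory_le hw
    have h2 := SphereNet.add_one_le_log_size k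
    have h3 : (1 : ℝ) ≤ k + 1 := by simp
    have h4 : (k + 1 : ℝ) ≤ (k + 1) ^ 6 := le_self_pow₀ h3 (by norm_num)
    have h5 : (k + 1 : ℝ) ^ 6 ≤ (2 * Real.log (SphereNet.network k).size) ^ 6 :=
      pow_le_pow_left₀ (by positivity) h2 6
    rw [mul_pow] at h1 h5
    linarith
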